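/- For an integer $n\ge 1$ and a real $0<\alpha<1$, let $\mathrm{PTP}_{n,\alpha}$ be the following partial Boolean function. Its inputs are the $n\times n$ matrices $x$ with entries in $\{0,1\}$ in which every row contains exactly one $1$ and in which the number of columns containing a $1$ is either exactly $n$ or at most $\alpha n$; its value is $1$ in the former case and $0$ in the latter. Such a matrix encodes the function $\phi\colon\{1,\dots,n\}\to\{1,\dots,n\}$ with $\phi(i)=j$ if and only if $x_{i,j}=1$. A quantum query algorithm has query access to $\phi$ through the unitary $|i,b,w\rangle\mapsto|i,\,b+\phi(i) \bmod n,\,w\rangle$, its cost is the number of queries, and it has error $\varepsilon$ if on every input it outputs the wrong value with probability at most $\varepsilon$. Let $\deg_\varepsilon(f)$ denote the least total degree of a real polynomial $p$ in the entries of $x$ with $|p(x)-f(x)|\le\varepsilon$ for all $x$ in the domain of $f$. **Theorem.** Let $0<\alpha<1$ be a constant. Then there is a constant $C=C(\alpha)$ such that for all integers $n\ge1$ and all reals $\varepsilon$ with $3^{-n}\le\varepsilon\le 1/3$, the problem $\mathrm{PTP}_{n,\alpha}$ has an $\varepsilon$-error quantum query algorithm with cost at most $C\,n^{1/3}\left(\log\frac1\varepsilon\right)^{2/3}$,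 and moreover $$\deg_\varepsilon(\mathrm{PTP}_{n,\alpha})\le C\,n^{1/3}\left(\log\frac1\varepsilon\right)^{2/3}.$$ -/

import Mathlib

/-- The set `𝒟_{n,r}` of Boolean matrices of size `n × r` (regarded as points with coordinates
`0`, `1` in real space) in which every row has exactly one `1`. -/
def rowMatrices (n r : ℕ) : Set (Fin n × Fin r → ℝ) :=
  {x | (∀ p, x p = 0 ∨ x p = 1) ∧ ∀ i, ∃! j, x (i, j) = 1}

/-- The mapping `φ : {1, …, n} → {1, …, r}` that a matrix in `𝒟_{n,r}` stands for:
`φ i` is the column of the unique `1` in row `i`. -/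
noncomputable def toMapping {n r : ℕ} (x : Fin n × Fin r → ℝ) (hx : x ∈ rowMatrices n r) :
    Fin n → Fin r :=
  fun i => (hx.2 i).choose

theorem toMapping_eq_iff {n r : ℕ} {x : Fin n × Fin r → ℝ} (hx : x ∈ rowMatrices n r)
    (i : Fin n) (j : Fin r) : toMapping x hx i = j ↔ x (i, j) = 1 := by
  have h := (hx.2 i).choose_spec
  constructor
  · rintro rfl
    exact h.1
  · intro hj
    exact (h.2 j hj).symm

/-- The number of columns of `x` that contain a `1`. -/
noncomputable def columnCount {n r : ℕ} (x : Fin n × Fin r → ℝ) : ℕ :=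
  Set.ncard {j : Fin r | ∃ i, x (i, j) = 1}

/-- The domain of the permutation testing problem: the matrices in `𝒟_{n,n}` in which the number
of columns containing a `1` is either exactly `n` or at most `α n`. -/
def ptpDomain (n : ℕ) (α : ℝ) : Set (Fin n × Fin n → ℝ) :=
  {x | x ∈ rowMatrices n n ∧ (columnCount x = n ∨ (columnCount x : ℝ) ≤ α * n)}

theorem ptpDomain_subset (n : ℕ) (α : ℝ) : ptpDomain n α ⊆ rowMatrices n n :=
  fun _ hx => hx.1

/-- The permutation testing problem, true exactly when all `n` columns contain a `1`. -/
noncomputable def ptp (n : ℕ) (α : ℝ) (x : ptpDomain n α) : Bool :=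
  decide (columnCount x.1 = n)

/-- The total degree of a multivariate real polynomial, with `deg 0 = -∞`. -/
noncomputable def polyDegree {σ : Type*} (p : MvPolynomial σ ℝ) : WithBot ℕ∞ :=
  p.support.sup fun m => ((m.degree : ℕ∞) : WithBot ℕ∞)

/-- The `ε`-approximate degree of `f : X → ℝ`: the least degree of a real polynomial `p` with
`|p(x) - f(x)| ≤ ε` for all `x ∈ X`, nothing being required of `p` outside `X`. -/
noncomputable def approxDegree {σ : Type*} {X : Set (σ → ℝ)} (ε : ℝ) (f : X → ℝ) :
    WithBot ℕ∞ :=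
  ⨅ p ∈ {p : MvPolynomial σ ℝ | ∀ x : X, |MvPolynomial.eval x.1 p - f x| ≤ ε}, polyDegree p

/-- A quantum query algorithm with query access to a function `φ : {1, …, n} → {1, …, r}`.
Its Hilbert space has the orthonormal basis `|i, b, w⟩`, with a query register `i`, an answer
register `b`, and a finite work register `w`. From the basis state `start` it applies
`U 0`, query, `U 1`, query, …, query, `U queries`, where the unitaries do not depend on `φ`;
it then measures in this basis and answers according to `output`.
(The values `U t` with `t > queries` are never used.) -/
structure QueryAlgorithm (n r : ℕ) where
  W : Type
  [fintypeW : Fintype W]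
  [decidableEqW : DecidableEq W]
  queries : ℕ
  U : ℕ → Matrix.unitaryGroup (Fin n × Fin r × W) ℂ
  start : Fin n × Fin r × W
  output : Fin n × Fin r × W → Bool

attribute [instance] QueryAlgorithm.fintypeW QueryAlgorithm.decidableEqW

namespace QueryAlgorithm

variable {n r : ℕ}

/-- The query operator `|i, b, w⟩ ↦ |i, b + φ(i), w⟩`, with addition modulo `r`, acting on a vector
of amplitudes. -/
def query {W : Type} (φ : Fin n → Fin r) (ψ : Fin n × Fin r × W → ℂ) :
    Fin n × Fin r × W → ℂ :=
  fun s => ψ (s.1, s.2.1 - φ s.1, s.2.2)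

/-- The state after `t` queries and the application of `U t`. -/
noncomputable def state (A : QueryAlgorithm n r) (φ : Fin n → Fin r) :
    ℕ → (Fin n × Fin r × A.W → ℂ)
  | 0 => Matrix.mulVec (A.U 0).1 (Pi.single A.start 1)
  | t + 1 => Matrix.mulVec (A.U (t + 1)).1 (query φ (A.state φ t))

/-- The probability that the algorithm answers `b` on the input `φ`. -/
noncomputable def outputProb (A : QueryAlgorithm n r) (φ : Fin n → Fin r) (b : Bool) : ℝ :=
  ∑ s : Fin n × Fin r × A.W, if A.output s = b then ‖A.state φ A.queries s‖ ^ 2 else 0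

/-- The algorithm computes `f : X → {0,1}`, where `X ⊆ 𝒟_{n,r}`, with error `ε`: on every input
in `X`, it gives the wrong answer with probability at most `ε`. -/
def ComputesWithError (A : QueryAlgorithm n r) {X : Set (Fin n × Fin r → ℝ)}
    (hX : X ⊆ rowMatrices n r) (f : X → Bool) (ε : ℝ) : Prop :=
  ∀ x : X, A.outputProb (toMapping x.1 (hX x.2)) (!f x) ≤ ε

end QueryAlgorithm

/-! The algorithm is a collision search in the style of Brassard, Høyer and Tapp. Put β = 1 - α, L =
log(1/ε) and X = n^(1/3) L^(2/3). If `φ` has at most αn values, then at least βn points share their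
value with another point. Query k = O(X/β) random points. Except with probability exponentially
small in X, at least t = βX/4 distinct colliding points are among them, and then at least t points
collide with a sample point other than themselves (`card_filter_sample_lt_le`,
`card_sample_inter_collidingPoints_le`).

Grover search then looks for such a point. With marked fraction w/2, a round of r iterations
followed by a check multiplies the amplitude of "nothing found so far" by T_r(1 - w), a Chebyshev
value. Rounds of lengths 1, 2, 4, ..., 2^(l-1) give a telescoping product of cosines of size at most
1/(2^l √w), whatever w is (`abs_prod_T_two_pow_le`). With 2^l of order √(n/t) the product is at most
1/2; about 2L repetitions on the same sample bring the error to order ε² at cost O(L √(n/t)) =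
O(X/β). The algorithm accepts when no collision is found, so permutations are accepted with
certainty.

The degree bound follows by the polynomial method: an acceptance probability after T queries is a
polynomial of degree at most 2T in the matrix entries. -/

namespace QueryAlgorithm

/-! ### Circuits with a given number of queries. -/

/-- `Implementable n r W T V`: on the space with work register `W`, the family of operators `V`
(one for each mapping) is a product of unitaries independent of the mapping and `T` queries. -/
inductive Implementable (n r : ℕ) (W : Type) [Fintype W] [DecidableEq W] :
    ℕ → ((Fin n → Fin r) → (Fin n × Fin r × W → ℂ) → (Fin n × Fin r × W → ℂ)) → Prop
  | unitary (U : Matrix.unitaryGroup (Fin n × Fin r × W) ℂ) :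
      Implementable n r W 0 (fun _ ψ => Matrix.mulVec U.1 ψ)
  | query (T V) (U : Matrix.unitaryGroup (Fin n × Fin r × W) ℂ) :
      Implementable n r W T V →
        Implementable n r W (T + 1) (fun φ ψ => Matrix.mulVec U.1 (query φ (V φ ψ)))

section Implementable

variable {n r : ℕ} {W : Type} [Fintype W] [DecidableEq W]

theorem Implementable.unitary_comp {T : ℕ}
    {V : (Fin n → Fin r) → (Fin n × Fin r × W → ℂ) → (Fin n × Fin r × W → ℂ)}
    (hV : Implementable n r W T V) (U : Matrix.unitaryGroup (Fin n × Fin r × W) ℂ) :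
    Implementable n r W T (fun φ ψ => Matrix.mulVec U.1 (V φ ψ)) := by
  cases hV with
  | unitary U' => simpa using Implementable.unitary (r := r) (U * U')
  | query T V U' hV => simpa using Implementable.query T V (U * U') hV

theorem Implementable.comp {T T' : ℕ}
    {V V' : (Fin n → Fin r) → (Fin n × Fin r × W → ℂ) → (Fin n × Fin r × W → ℂ)}
    (hV' : Implementable n r W T' V') (hV : Implementable n r W T V) :
    Implementable n r W (T + T') (fun φ ψ => V' φ (V φ ψ)) := by
  induction hV' with
  | unitary U => exact hV.unitary_comp U
  | query T' V' U _ ih => exact Implementable.query _ _ U ih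

theorem implementable_id : Implementable n r W 0 (fun _ ψ => ψ) := by
  simpa using Implementable.unitary (n := n) (r := r) (W := W) 1

theorem implementable_query :
    Implementable n r W 1 (fun φ ψ => query φ ψ) := by
  simpa using Implementable.query 0 _ 1 (implementable_id (n := n) (r := r) (W := W))

theorem state_congr {T T' : ℕ} {U U' : ℕ → Matrix.unitaryGroup (Fin n × Fin r × W) ℂ}
    (start : Fin n × Fin r × W) (output : Fin n × Fin r × W → Bool) (φ : Fin n → Fin r) (t : ℕ)
    (h : ∀ s ≤ t, U s = U' s) :
    (⟨W, T, U, start, output⟩ : QueryAlgorithm n r).state φ t =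
      (⟨W, T', U', start, output⟩ : QueryAlgorithm n r).state φ t := by
  induction t with
  | zero => simp only [state, h 0 le_rfl]
  | succ t ih => simp only [state, h (t + 1) le_rfl, ih fun s hs => h s (by omega)]

theorem Implementable.exists_state_eq {T : ℕ}
    {V : (Fin n → Fin r) → (Fin n × Fin r × W → ℂ) → (Fin n × Fin r × W → ℂ)}
    (hV : Implementable n r W T V) :
    ∃ U : ℕ → Matrix.unitaryGroup (Fin n × Fin r × W) ℂ,
      ∀ (start : Fin n × Fin r × W) (output : Fin n × Fin r × W → Bool) (φ : Fin n → Fin r),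
        (⟨W, T, U, start, output⟩ : QueryAlgorithm n r).state φ T = V φ (Pi.single start 1) := by
  induction hV with
  | unitary U => exact ⟨fun _ => U, fun _ _ _ => rfl⟩
  | query T V U _ ih =>
    obtain ⟨U', hU'⟩ := ih
    refine ⟨Function.update U' (T + 1) U, fun start output φ => ?_⟩
    beta_reduce
    rw [← hU' start output φ]
    simp only [state, Function.update_self]
    rw [state_congr (T' := T) (U' := U')]
    intro s hs
    rw [Function.update_of_ne (by omega)]

end Implementable

/-! ### The input-independent unitaries that serve as building blocks. -/

section Unitaries

variable {X : Type*} [Fintype X] [DecidableEq X]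

theorem sum_norm_sq_mulVec (U : Matrix.unitaryGroup X ℂ) (ψ : X → ℂ) :
    ∑ x, ‖Matrix.mulVec U.1 ψ x‖ ^ 2 = ∑ x, ‖ψ x‖ ^ 2 := by
  have key : ∀ v : X → ℂ, ((∑ x, ‖v x‖ ^ 2 : ℝ) : ℂ) = star v ⬝ᵥ v := by
    intro v
    simp [dotProduct, Complex.conj_mul']
  have : ((∑ x, ‖Matrix.mulVec U.1 ψ x‖ ^ 2 : ℝ) : ℂ) = ((∑ x, ‖ψ x‖ ^ 2 : ℝ) : ℂ) := by
    have hU : star U.1 * U.1 = 1 := Matrix.mem_unitaryGroup_iff'.1 U.2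
    rw [key, key, Matrix.star_mulVec, Matrix.dotProduct_mulVec, Matrix.vecMul_vecMul,
      ← Matrix.star_eq_conjTranspose, hU, Matrix.vecMul_one]
  exact_mod_cast this

theorem exists_unitary_comp_equiv (e : Equiv.Perm X) :
    ∃ U : Matrix.unitaryGroup X ℂ, ∀ ψ, Matrix.mulVec U.1 ψ = fun x => ψ (e x) := by
  refine ⟨⟨e.permMatrix ℂ, ?_⟩, fun ψ => ?_⟩
  · rw [Matrix.mem_unitaryGroup_iff, Matrix.star_eq_conjTranspose, Matrix.conjTranspose_permMatrix,
      ← Matrix.permMatrix_mul]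
    simp
  · exact Matrix.permMatrix_mulVec ..

theorem exists_unitary_sign (f : X → Bool) :
    ∃ U : Matrix.unitaryGroup X ℂ,
      ∀ ψ, Matrix.mulVec U.1 ψ = fun x => if f x then -ψ x else ψ x := by
  refine ⟨⟨Matrix.diagonal fun x => if f x then -1 else 1, ?_⟩, fun ψ => ?_⟩
  · rw [Matrix.mem_unitaryGroup_iff, Matrix.star_eq_conjTranspose, Matrix.diagonal_conjTranspose,
      Matrix.diagonal_mul_diagonal, ← Matrix.diagonal_one]
    congr 1
    funext x
    by_cases h : f x <;> simp [h]
  · funext x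
    by_cases h : f x <;> simp [Matrix.mulVec_diagonal, h]

theorem exists_unitary_reflection (P : Matrix X X ℂ) (hP : P * P = P) (hP' : star P = P) :
    ∃ U : Matrix.unitaryGroup X ℂ,
      ∀ ψ, Matrix.mulVec U.1 ψ = fun x => 2 * Matrix.mulVec P ψ x - ψ x := by
  refine ⟨⟨2 • P - 1, ?_⟩, fun ψ => ?_⟩
  · rw [Matrix.mem_unitaryGroup_iff]
    simp only [star_sub, star_nsmul, star_one, hP']
    have : (2 • P - 1) * (2 • P - 1) = 4 • (P * P) - 4 • P + 1 := by noncomm_ring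
    rw [this, hP]
    simp
  · funext x
    change Matrix.mulVec (2 • P - 1) ψ x = _
    rw [two_nsmul, Matrix.sub_mulVec, Matrix.add_mulVec, Matrix.one_mulVec, Pi.sub_apply,
      Pi.add_apply, two_mul]

/-- The unit vector `u` is extended to an orthonormal basis, whose vectors become the columns of the
unitary. -/
theorem exists_unitary_mulVec_single (x₀ : X) (u : X → ℂ) (hu : ∑ x, ‖u x‖ ^ 2 = 1) :
    ∃ U : Matrix.unitaryGroup X ℂ, Matrix.mulVec U.1 (Pi.single x₀ 1) = u := by
  obtain ⟨b, hb⟩ := Orthonormal.exists_orthonormalBasis_extension_of_card_eq (𝕜 := ℂ)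
    (E := EuclideanSpace ℂ X) (ι := X) (by simp) (v := fun _ => WithLp.toLp 2 u) (s := {x₀}) (by
      rw [orthonormal_iff_ite]
      rintro ⟨i, rfl⟩ ⟨j, rfl⟩
      simp only [if_true]
      rw [Set.domRestrict_apply, inner_self_eq_norm_sq_to_K]
      have h : ‖WithLp.toLp 2 u‖ ^ 2 = 1 := by rw [EuclideanSpace.norm_sq_eq]; exact hu
      rw [← RCLike.ofReal_pow, h, RCLike.ofReal_one])
  refine ⟨⟨_, (EuclideanSpace.basisFun X ℂ).toMatrix_orthonormalBasis_mem_unitary b⟩, ?_⟩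
  funext x
  simp [Module.Basis.toMatrix_apply, hb x₀ rfl]

end Unitaries

end QueryAlgorithm

namespace QueryAlgorithm

/-! ### Using the value of `φ` and erasing it again. -/

section Gadgets

variable {n : ℕ} [NeZero n] {W : Type} [Fintype W] [DecidableEq W]

/-- Negating the answer register before and after turns addition of `φ i` into subtraction. -/
theorem implementable_inverse_query :
    Implementable n n W 1 (fun φ ψ x => ψ (x.1, x.2.1 + φ x.1, x.2.2)) := by
  have he : Function.Involutive fun x : Fin n × Fin n × W => (x.1, -x.2.1, x.2.2) := by
    intro x; simp
  obtain ⟨U, hU⟩ := exists_unitary_comp_equiv he.toPerm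
  have h := ((Implementable.unitary (n := n) (r := n) (W := W) U).comp
    implementable_query).comp (Implementable.unitary U)
  convert h using 1
  funext φ ψ x
  simp only [hU, query, Function.Involutive.coe_toPerm]
  congr 2
  rw [show -(-x.2.1 - φ x.1) = x.2.1 + φ x.1 by abel]

/-- Compute, act, uncompute: `U` sees the value in the answer register, which the inverse query then
clears. -/
theorem implementable_conj_query (U : Matrix.unitaryGroup (Fin n × Fin n × W) ℂ) :
    Implementable n n W 2 (fun φ ψ x =>
      Matrix.mulVec U.1 (query φ ψ) (x.1, x.2.1 + φ x.1, x.2.2)) :=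
  (implementable_inverse_query.comp
    ((Implementable.unitary (n := n) (r := n) (W := W) U).comp implementable_query))

theorem implementable_phase (f : Fin n × Fin n × W → Bool) :
    Implementable n n W 2 (fun φ ψ x =>
      if f (x.1, x.2.1 + φ x.1, x.2.2) then -ψ x else ψ x) := by
  obtain ⟨U, hU⟩ := exists_unitary_sign f
  convert implementable_conj_query U using 1
  funext φ ψ x
  simp [hU, query]

end Gadgets

/-! ### Grover search for a point colliding with the sample. -/

/-- The work register of the collision search: `k` pairs (sampled point, its image), a coin, and a
counter modulo `K + 1`. -/
abbrev SearchRegister (n k K : ℕ) : Type := (Fin k → Fin n × Fin n) × Bool × Fin (K + 1)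

/-- The point `i` collides under `φ` with a sampled point other than `i`. -/
def Collides {n k : ℕ} (φ : Fin n → Fin n) (s : Fin k → Fin n) (i : Fin n) : Prop :=
  ∃ a, s a ≠ i ∧ φ (s a) = φ i

instance {n k : ℕ} (φ : Fin n → Fin n) (s : Fin k → Fin n) : DecidablePred (Collides φ s) :=
  fun _ => inferInstanceAs (Decidable (∃ _, _))

/-- The number of points that collide with a sampled point. -/
def collisionCount {n k : ℕ} (φ : Fin n → Fin n) (s : Fin k → Fin n) : ℕ :=
  (Finset.univ.filter (Collides φ s)).card

/-- After at most `j` checks, the branch where the counter is `0` has amplitude `y s` on the marked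
and `x s` on the unmarked basis states whose memory holds the sample `s` and its images. -/
structure IsSearchState {n k K : ℕ} [NeZero n] (φ : Fin n → Fin n) (j : ℕ)
    (x y : (Fin k → Fin n) → ℝ) (ψ : Fin n × Fin n × SearchRegister n k K → ℂ) : Prop where
  vanish : ∀ i b m c z, j < z.val → ψ (i, b, m, c, z) = 0
  value : ∀ i b m c, ψ (i, b, m, c, 0) =
    if b = 0 ∧ ∀ a, (m a).2 = φ (m a).1 then
      ((if c = true ∧ Collides φ (fun a => (m a).1) i then y fun a => (m a).1
        else x fun a => (m a).1 : ℝ) : ℂ) else 0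

theorem sum_ite_marked {n k : ℕ} (φ : Fin n → Fin n) (s : Fin k → Fin n) (u v : ℝ) :
    ∑ p : Fin n × Bool, (if p.2 = true ∧ Collides φ s p.1 then v else u) =
      collisionCount φ s * v + (2 * n - collisionCount φ s) * u := by
  have h : ∀ p : Fin n × Bool, (if p.2 = true ∧ Collides φ s p.1 then v else u) =
      u + if p.2 = true ∧ Collides φ s p.1 then v - u else 0 := by
    intro p; split_ifs <;> simp
  simp only [h, Finset.sum_add_distrib, Fintype.sum_prod_type, Fintype.sum_bool,
    Bool.false_eq_true, false_and, if_false, add_zero, true_and]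
  rw [← Finset.sum_filter]
  simp [collisionCount]
  ring

section Search

variable {n k K : ℕ} [NeZero n]

/-- The test for a marked state, when the answer register holds the image of the query register. -/
def isMarked (x : Fin n × Fin n × SearchRegister n k K) : Bool :=
  x.2.2.2.1 && decide (∃ a, (x.2.2.1 a).1 ≠ x.1 ∧ (x.2.2.1 a).2 = x.2.1)

theorem isMarked_eq_true_iff {φ : Fin n → Fin n} {m : Fin k → Fin n × Fin n}
    (hm : ∀ a, (m a).2 = φ (m a).1) (i : Fin n) (c : Bool) (z : Fin (K + 1)) :
    isMarked (i, 0 + φ i, m, c, z) = true ↔ c = true ∧ Collides φ (fun a => (m a).1) i := by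
  simp [isMarked, Collides, hm]

/-- The phase oracle. -/
def phaseOracle (φ : Fin n → Fin n) (ψ : Fin n × Fin n × SearchRegister n k K → ℂ) :
    Fin n × Fin n × SearchRegister n k K → ℂ :=
  fun x => if isMarked (x.1, x.2.1 + φ x.1, x.2.2) then -ψ x else ψ x

theorem implementable_phaseOracle :
    Implementable n n (SearchRegister n k K) 2 phaseOracle :=
  implementable_phase isMarked

theorem IsSearchState.phaseOracle {φ : Fin n → Fin n} {j : ℕ} {x y : (Fin k → Fin n) → ℝ}
    {ψ : Fin n × Fin n × SearchRegister n k K → ℂ} (h : IsSearchState φ j x y ψ) :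
    IsSearchState φ j x (fun s => -y s) (phaseOracle φ ψ) where
  vanish i b m c z hz := by simp [QueryAlgorithm.phaseOracle, h.vanish i b m c z hz]
  value i b m c := by
    simp only [QueryAlgorithm.phaseOracle, h.value]
    by_cases hb : b = 0 ∧ ∀ a, (m a).2 = φ (m a).1
    · obtain ⟨rfl, hm⟩ := hb
      have := isMarked_eq_true_iff (K := K) hm i c 0
      by_cases hc : c = true ∧ Collides φ (fun a => (m a).1) i
      · simp only [this.2 hc, if_pos hc, hm]
        simp
      · have h' : isMarked (i, 0 + φ i, m, c, (0 : Fin (K + 1))) = false := by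
          rw [← Bool.not_eq_true, this]; exact hc
        simp only [h', hm, hc]
        simp
    · simp [hb]

/-- The operation that increments the counter on marked states. -/
def check (φ : Fin n → Fin n) (ψ : Fin n × Fin n × SearchRegister n k K → ℂ) :
    Fin n × Fin n × SearchRegister n k K → ℂ :=
  fun x => ψ (x.1, x.2.1, x.2.2.1, x.2.2.2.1,
    x.2.2.2.2 - if isMarked (x.1, x.2.1 + φ x.1, x.2.2) then 1 else 0)

theorem implementable_check :
    Implementable n n (SearchRegister n k K) 2 check := by
  let e : Equiv.Perm (Fin n × Fin n × SearchRegister n k K) :=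
    { toFun := fun x => (x.1, x.2.1, x.2.2.1, x.2.2.2.1,
        x.2.2.2.2 - if isMarked x then 1 else 0)
      invFun := fun x => (x.1, x.2.1, x.2.2.1, x.2.2.2.1,
        x.2.2.2.2 + if isMarked x then 1 else 0)
      left_inv := fun x => by simp [isMarked]
      right_inv := fun x => by simp [isMarked] }
  obtain ⟨U, hU⟩ := exists_unitary_comp_equiv e
  convert implementable_conj_query U using 1
  funext φ ψ x
  simp [hU, query, check, e]

theorem IsSearchState.check {φ : Fin n → Fin n} {j : ℕ} {x y : (Fin k → Fin n) → ℝ}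
    {ψ : Fin n × Fin n × SearchRegister n k K → ℂ} (h : IsSearchState φ j x y ψ) (hj : j < K) :
    IsSearchState φ (j + 1) x (fun _ => 0) (check φ ψ) where
  vanish i b m c z hz := by
    simp only [QueryAlgorithm.check]
    apply h.vanish
    split_ifs
    · have hz1 : (1 : Fin (K + 1)) ≤ z := by
        rw [Fin.le_def, Fin.val_one', Nat.mod_eq_of_lt (by omega)]; omega
      rw [Fin.sub_val_of_le hz1, Fin.val_one', Nat.mod_eq_of_lt (by omega)]
      omega
    · simp only [sub_zero]; omega
  value i b m c := by
    simp only [QueryAlgorithm.check]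
    -- A marked state reaches counter `0` only by wrapping around from `K`, and that branch is still
    -- empty because `j < K`.
    have hlast : j < (0 - 1 : Fin (K + 1)).val := by
      rw [zero_sub, Fin.coe_neg_one]; exact hj
    by_cases hb : b = 0 ∧ ∀ a, (m a).2 = φ (m a).1
    · obtain ⟨rfl, hm⟩ := hb
      have := isMarked_eq_true_iff (K := K) hm i c 0
      by_cases hc : c = true ∧ Collides φ (fun a => (m a).1) i
      · simp only [this.2 hc, if_true]
        rw [h.vanish _ _ _ _ _ hlast]
        simp [hc]
      · have h' : isMarked (i, 0 + φ i, m, c, (0 : Fin (K + 1))) = false := by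
          rw [← Bool.not_eq_true, this]; exact hc
        simp only [h']
        simp [h.value, hm, hc]
    · rw [if_neg hb]
      split_ifs
      · exact h.vanish _ _ _ _ _ hlast
      · rw [sub_zero, h.value, if_neg hb]

/-- The inversion about the mean of the query register and the coin. -/
noncomputable def diffusion (ψ : Fin n × Fin n × SearchRegister n k K → ℂ) :
    Fin n × Fin n × SearchRegister n k K → ℂ :=
  fun x => 2 * ((2 * n : ℂ)⁻¹ * ∑ p : Fin n × Bool,
    ψ (p.1, x.2.1, x.2.2.1, p.2, x.2.2.2.2)) - ψ x

theorem implementable_diffusion :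
    Implementable n n (SearchRegister n k K) 0 (fun _ => diffusion) := by
  let P : Matrix (Fin n × Fin n × SearchRegister n k K) (Fin n × Fin n × SearchRegister n k K) ℂ :=
    fun x y => if x.2.1 = y.2.1 ∧ x.2.2.1 = y.2.2.1 ∧ x.2.2.2.2 = y.2.2.2.2 then (2 * n : ℂ)⁻¹ else 0
  have hmul : ∀ ψ x, Matrix.mulVec P ψ x = (2 * n : ℂ)⁻¹ * ∑ p : Fin n × Bool,
      ψ (p.1, x.2.1, x.2.2.1, p.2, x.2.2.2.2) := by
    intro ψ x
    simp only [Matrix.mulVec, dotProduct, P, Fintype.sum_prod_type, ite_and, ite_mul, zero_mul]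
    simp [Finset.sum_ite_eq, Finset.mul_sum, mul_add]
  have hstar : star P = P := by
    ext x y
    change star (P y x) = P x y
    simp only [P, apply_ite star]
    simp [eq_comm]
  have hsq : P * P = P := by
    ext x y
    have : (P * P) x y = Matrix.mulVec P (fun z => P z y) x := rfl
    rw [this, hmul]
    have hn : (n : ℂ) ≠ 0 := Nat.cast_ne_zero.2 (NeZero.ne n)
    simp only [P]
    split_ifs
    · simp
      field_simp
    · simp
  obtain ⟨U, hU⟩ := exists_unitary_reflection P hsq hstar
  convert Implementable.unitary (r := n) U using 1
  funext φ ψ x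
  rw [hU]
  beta_reduce
  rw [hmul]
  rfl

/-- With w = `collisionCount φ s / n`, the mean amplitude over the 2n states of query register and
coin is (1 - w/2) x + (w/2) y. -/
theorem IsSearchState.diffusion {φ : Fin n → Fin n} {j : ℕ} {x y : (Fin k → Fin n) → ℝ}
    {ψ : Fin n × Fin n × SearchRegister n k K → ℂ} (h : IsSearchState φ j x y ψ) :
    IsSearchState φ j
      (fun s => (1 - collisionCount φ s / n) * x s + collisionCount φ s / n * y s)
      (fun s => (2 - collisionCount φ s / n) * x s - (1 - collisionCount φ s / n) * y s)
      (diffusion ψ) where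
  vanish i b m c z hz := by
    simp [QueryAlgorithm.diffusion, h.vanish _ _ _ _ z hz]
  value i b m c := by
    simp only [QueryAlgorithm.diffusion, h.value]
    by_cases hb : b = 0 ∧ ∀ a, (m a).2 = φ (m a).1
    · simp only [if_pos hb]
      rw [← Complex.ofReal_sum, sum_ite_marked]
      have hn : (n : ℂ) ≠ 0 := Nat.cast_ne_zero.2 (NeZero.ne n)
      split_ifs
      · push_cast; field_simp; ring
      · push_cast; field_simp; ring
    · simp [hb]

/-- The state after `r` Grover iterations. -/
noncomputable def groverIterate (φ : Fin n → Fin n) :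
    ℕ → (Fin n × Fin n × SearchRegister n k K → ℂ) → Fin n × Fin n × SearchRegister n k K → ℂ
  | 0, ψ => ψ
  | r + 1, ψ => diffusion (phaseOracle φ (groverIterate φ r ψ))

theorem implementable_groverIterate (r : ℕ) :
    Implementable n n (SearchRegister n k K) (2 * r) (fun φ => groverIterate φ r) := by
  induction r with
  | zero => exact implementable_id
  | succ r ih => exact implementable_diffusion.comp (implementable_phaseOracle.comp ih)

open Polynomial.Chebyshev in
-- An iteration is a rotation by the angle whose cosine is 1 - w, so its powers obey the Chebyshev
-- recurrences. The index `r - 1` is an integer: at `r = 0` it gives U₋₁ = 0, matching the empty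
-- marked part.
theorem IsSearchState.groverIterate {φ : Fin n → Fin n} {j : ℕ} {x : (Fin k → Fin n) → ℝ}
    {ψ : Fin n × Fin n × SearchRegister n k K → ℂ} (h : IsSearchState φ j x (fun _ => 0) ψ)
    (r : ℕ) :
    IsSearchState φ j
      (fun s => (T ℝ r).eval (1 - collisionCount φ s / n : ℝ) * x s)
      (fun s => (2 - collisionCount φ s / n) *
        (Polynomial.Chebyshev.U ℝ (r - 1)).eval (1 - collisionCount φ s / n : ℝ) * x s)
      (groverIterate φ r ψ) := by
  induction r with
  | zero => simpa [QueryAlgorithm.groverIterate] using h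
  | succ r ih =>
    change IsSearchState φ j _ _ (QueryAlgorithm.diffusion _)
    convert ih.phaseOracle.diffusion using 1
    · funext s
      have := congrArg (Polynomial.eval (1 - collisionCount φ s / n : ℝ))
        (T_eq_X_mul_T_sub_pol_U ℝ (r - 1))
      rw [show (r - 1 + 2 : ℤ) = (r + 1 : ℕ) by push_cast; ring,
        show (r - 1 + 1 : ℤ) = r by ring] at this
      rw [this]
      simp
      ring
    · funext s
      have := congrArg (Polynomial.eval (1 - collisionCount φ s / n : ℝ))
        (U_eq_X_mul_U_add_T ℝ (r - 1))
      rw [show (r - 1 + 1 : ℤ) = r by ring] at this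
      rw [show ((r + 1 : ℕ) - 1 : ℤ) = r by push_cast; ring, this]
      simp
      ring

/-- Grover iterations in rounds of the given lengths, with a check after each round. -/
noncomputable def searchRounds (φ : Fin n → Fin n) :
    List ℕ → (Fin n × Fin n × SearchRegister n k K → ℂ) → Fin n × Fin n × SearchRegister n k K → ℂ
  | [], ψ => ψ
  | r :: l, ψ => searchRounds φ l (check φ (groverIterate φ r ψ))

theorem implementable_searchRounds (l : List ℕ) :
    Implementable n n (SearchRegister n k K) (l.map fun r => 2 * r + 2).sum
      (fun φ => searchRounds φ l) := by
  induction l with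
  | nil => exact implementable_id
  | cons r l ih =>
    exact ih.comp (implementable_check.comp (implementable_groverIterate r))

open Polynomial.Chebyshev in
theorem IsSearchState.searchRounds {φ : Fin n → Fin n} (l : List ℕ) {j : ℕ}
    {x : (Fin k → Fin n) → ℝ} {ψ : Fin n × Fin n × SearchRegister n k K → ℂ}
    (h : IsSearchState φ j x (fun _ => 0) ψ) (hj : j + l.length ≤ K) :
    IsSearchState φ (j + l.length)
      (fun s => (l.map fun r : ℕ => (T ℝ r).eval (1 - collisionCount φ s / n : ℝ)).prod * x s)
      (fun _ => 0) (searchRounds φ l ψ) := by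
  induction l generalizing j x ψ with
  | nil => simpa [QueryAlgorithm.searchRounds] using h
  | cons r l ih =>
    simp only [List.length_cons] at hj
    change IsSearchState φ _ _ _ (QueryAlgorithm.searchRounds φ l _)
    convert ih ((h.groverIterate r).check (by omega)) (by omega) using 1
    · simp only [List.length_cons]; omega
    · funext s
      simp only [List.map_cons, List.prod_cons]
      ring

end Search

end QueryAlgorithm

namespace QueryAlgorithm

/-! ### Preparing the sample, and the acceptance probability. -/

section Sampling

variable {n k K : ℕ}

theorem sum_memory (g : Fin n → Fin n) (F : (Fin k → Fin n) → ℝ) :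
    ∑ m : Fin k → Fin n × Fin n,
      (if ∀ a, (m a).2 = g (m a).1 then F fun a => (m a).1 else 0) = ∑ s, F s := by
  rw [← Finset.sum_filter]
  refine Finset.sum_nbij' (fun m a => (m a).1) (fun s a => (s a, g (s a))) (by simp) (by simp)
    ?_ (by simp) (by simp)
  intro m hm
  rw [Finset.mem_filter] at hm
  funext a
  exact Prod.ext rfl (hm.2 a).symm

/-- Memory slot `a` is swapped into the query and answer registers, queried and swapped back. -/
theorem implementable_load_one (a : Fin k) :
    Implementable n n (SearchRegister n k K) 1 (fun φ ψ x =>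
      ψ (x.1, x.2.1, Function.update x.2.2.1 a
        ((x.2.2.1 a).1, (x.2.2.1 a).2 - φ (x.2.2.1 a).1), x.2.2.2)) := by
  have he : Function.Involutive fun x : Fin n × Fin n × SearchRegister n k K =>
      ((x.2.2.1 a).1, (x.2.2.1 a).2, Function.update x.2.2.1 a (x.1, x.2.1), x.2.2.2) := by
    intro x; simp
  obtain ⟨U, hU⟩ := exists_unitary_comp_equiv he.toPerm
  have h := ((Implementable.unitary (n := n) (r := n) U).comp
    implementable_query).comp (Implementable.unitary U)
  convert h using 1
  funext φ ψ x
  simp [hU, query]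

theorem exists_implementable_load (t : ℕ) (ht : t ≤ k) :
    ∃ V, Implementable n n (SearchRegister n k K) t V ∧ ∀ φ ψ x, V φ ψ x =
      ψ (x.1, x.2.1, (fun a => if a.val < t then
        ((x.2.2.1 a).1, (x.2.2.1 a).2 - φ (x.2.2.1 a).1) else x.2.2.1 a), x.2.2.2) := by
  induction t with
  | zero => exact ⟨_, implementable_id, by simp⟩
  | succ t ih =>
    obtain ⟨V, hV, h⟩ := ih (by omega)
    refine ⟨_, (implementable_load_one ⟨t, ht⟩).comp hV, fun φ ψ x => ?_⟩
    rw [h]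
    congr 4
    funext a
    dsimp only
    rcases lt_trichotomy a.val t with hat | hat | hat
    · rw [if_pos hat, if_pos (by omega), Function.update_of_ne]
      exact fun h => by simp [h] at hat
    · obtain rfl : a = ⟨t, ht⟩ := Fin.ext hat
      simp
    · rw [if_neg (by omega), if_neg (by omega), Function.update_of_ne]
      exact fun h => by simp [h] at hat

variable [NeZero n]

theorem IsSearchState.sum_norm_sq {φ : Fin n → Fin n} {j : ℕ} {x y : (Fin k → Fin n) → ℝ}
    {ψ : Fin n × Fin n × SearchRegister n k K → ℂ} (h : IsSearchState φ j x y ψ) :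
    ∑ w, (if decide (w.2.2.2.2 = 0) = true then ‖ψ w‖ ^ 2 else 0) =
      ∑ s, (collisionCount φ s * y s ^ 2 + (2 * n - collisionCount φ s) * x s ^ 2) := by
  have h1 : ∀ i b m c, ‖ψ (i, b, m, c, 0)‖ ^ 2 = if b = 0 then
      if ∀ a, (m a).2 = φ (m a).1 then
        (if c = true ∧ Collides φ (fun a => (m a).1) i then (y fun a => (m a).1) ^ 2
          else (x fun a => (m a).1) ^ 2) else 0 else 0 := by
    intro i b m c
    rw [h.value, ite_and]
    split_ifs <;> simp
  simp only [Fintype.sum_prod_type, decide_eq_true_eq, Finset.sum_ite_eq', Finset.mem_univ, if_true,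
    h1]
  have h2 : ∀ i : Fin n, (∑ b : Fin n, ∑ m : Fin k → Fin n × Fin n, ∑ c : Bool,
      (if b = 0 then
      if ∀ a, (m a).2 = φ (m a).1 then
        (if c = true ∧ Collides φ (fun a => (m a).1) i then (y fun a => (m a).1) ^ 2
          else (x fun a => (m a).1) ^ 2) else 0 else 0)) =
      ∑ m : Fin k → Fin n × Fin n, ∑ c : Bool, if ∀ a, (m a).2 = φ (m a).1 then
        (if c = true ∧ Collides φ (fun a => (m a).1) i then (y fun a => (m a).1) ^ 2
          else (x fun a => (m a).1) ^ 2) else 0 := by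
    intro i
    rw [Finset.sum_eq_single 0]
    · simp
    · intro b _ hb; simp [hb]
    · simp
  simp only [h2]
  rw [Finset.sum_comm, ← sum_memory φ]
  refine Finset.sum_congr rfl fun m _ => ?_
  rw [← Fintype.sum_prod_type' (f := fun i c => if ∀ a, (m a).2 = φ (m a).1 then
        (if c = true ∧ Collides φ (fun a => (m a).1) i then (y fun a => (m a).1) ^ 2
          else (x fun a => (m a).1) ^ 2) else 0)]
  split_ifs
  · exact sum_ite_marked φ _ _ _
  · simp

theorem exists_unitary_uniform_sample (start : Fin n × Fin n × SearchRegister n k K) :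
    ∃ U : Matrix.unitaryGroup (Fin n × Fin n × SearchRegister n k K) ℂ,
      Matrix.mulVec U.1 (Pi.single start 1) = fun w =>
        if w.2.2.2.2 = 0 ∧ w.2.1 = 0 ∧ ∀ a, (w.2.2.1 a).2 = 0 then
          (((√(n ^ k * (2 * n)))⁻¹ : ℝ) : ℂ) else 0 := by
  apply exists_unitary_mulVec_single
  set κ : ℝ := (√(n ^ k * (2 * n)))⁻¹
  have hκ : κ ^ 2 = (n ^ k * (2 * n) : ℝ)⁻¹ := by
    rw [inv_pow, Real.sq_sqrt (by positivity)]
  -- A memory with all images zero is one loaded with the constant map 0, so the norm formula for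
  -- search states yields the normalisation.
  have h : IsSearchState (K := K) (k := k) (fun _ : Fin n => 0) 0 (fun _ => κ) (fun _ => κ)
      (fun w => if w.2.2.2.2 = 0 ∧ w.2.1 = 0 ∧ ∀ a, (w.2.2.1 a).2 = 0 then (κ : ℂ) else 0) := by
    constructor
    · intro i b m c z hz
      rw [if_neg]
      rintro ⟨rfl, -⟩
      simp at hz
    · intro i b m c
      simp
  have h1 := h.sum_norm_sq
  simp only [← add_mul, hκ] at h1
  have hn : (n : ℝ) ≠ 0 := Nat.cast_ne_zero.2 (NeZero.ne n)
  have h2 : ∑ s : Fin k → Fin n, ((collisionCount (fun _ => (0 : Fin n)) s : ℝ) +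
      (2 * n - collisionCount (fun _ => (0 : Fin n)) s)) * (n ^ k * (2 * n) : ℝ)⁻¹ = 1 := by
    simp only [add_sub_cancel]
    simp
    field_simp
  rw [← h2, ← h1]
  refine Finset.sum_congr rfl fun w _ => ?_
  by_cases hw : w.2.2.2.2 = 0 <;> simp [hw]

open Polynomial.Chebyshev in
/-- The collision search on a random sample of size `k`, with rounds of Grover iterations of the
given lengths. -/
theorem exists_collision_search (n k : ℕ) [NeZero n] (l : List ℕ) :
    ∃ A : QueryAlgorithm n n, A.queries = k + (2 + (l.map fun r => 2 * r + 2).sum) ∧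
      ∀ φ, A.outputProb φ true = (n ^ k : ℝ)⁻¹ * ∑ s : Fin k → Fin n,
        (l.map fun r : ℕ => (T ℝ r).eval (1 - collisionCount φ s / n : ℝ)).prod ^ 2 *
          (1 - collisionCount φ s / (2 * n)) := by
  -- One check after loading and one per round: the counter never wraps.
  let K := l.length + 1
  let start : Fin n × Fin n × SearchRegister n k K := (0, 0, fun _ => (0, 0), false, 0)
  obtain ⟨U, hU⟩ := exists_unitary_uniform_sample start
  obtain ⟨V, hV, hV'⟩ := exists_implementable_load (n := n) (k := k) (K := K) k le_rfl
  have himp := (((implementable_searchRounds (n := n) (k := k) (K := K) l).comp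
    implementable_check).comp hV).comp (Implementable.unitary U)
  rw [zero_add] at himp
  obtain ⟨Us, hUs⟩ := himp.exists_state_eq
  refine ⟨⟨SearchRegister n k K, k + (2 + (l.map fun r => 2 * r + 2).sum), Us, start,
    fun x => decide (x.2.2.2.2 = 0)⟩, rfl, fun φ => ?_⟩
  · set κ : ℝ := (√(n ^ k * (2 * n)))⁻¹ with hκ_def
    have hκ : κ ^ 2 = (n ^ k * (2 * n) : ℝ)⁻¹ := by
      rw [inv_pow, Real.sq_sqrt (by positivity)]
    have h0 : IsSearchState φ 0 (fun _ => κ) (fun _ => κ)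
        (V φ (Matrix.mulVec U.1 (Pi.single start 1))) := by
      constructor
      · intro i b m c z hz
        rw [hV', hU]
        dsimp only
        rw [if_neg]
        rintro ⟨rfl, -⟩
        simp at hz
      · intro i b m c
        rw [hV', hU]
        simp [sub_eq_zero]
    -- The first check empties the marked part, as the rounds require, and accounts for the factor 1
    -- - m/(2n), where m is the collision count.
    have h1 := ((h0.check (by omega)).searchRounds l (by omega)).sum_norm_sq
    unfold outputProb
    dsimp only
    rw [hUs]
    refine h1.trans ?_
    rw [Finset.mul_sum]
    refine Finset.sum_congr rfl fun s _ => ?_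
    have hn : (n : ℝ) ≠ 0 := Nat.cast_ne_zero.2 (NeZero.ne n)
    rw [mul_pow, hκ]
    field_simp
    ring

end Sampling

theorem sum_norm_sq_state {n r : ℕ} (A : QueryAlgorithm n r) (φ : Fin n → Fin r) (t : ℕ) :
    ∑ s, ‖A.state φ t s‖ ^ 2 = 1 := by
  induction t with
  | zero =>
    rw [state, sum_norm_sq_mulVec]
    rw [Finset.sum_eq_single A.start] <;> simp +contextual
  | succ t ih =>
    rw [state, sum_norm_sq_mulVec, ← ih]
    have hr : NeZero r := ⟨fun h => by subst h; exact (A.start.2.1).elim0⟩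
    let e : Equiv.Perm (Fin n × Fin r × A.W) :=
      { toFun := fun s => (s.1, s.2.1 - φ s.1, s.2.2)
        invFun := fun s => (s.1, s.2.1 + φ s.1, s.2.2)
        left_inv := fun s => by simp
        right_inv := fun s => by simp }
    exact Equiv.sum_comp e fun s => ‖A.state φ t s‖ ^ 2

theorem outputProb_true_add_false {n r : ℕ} (A : QueryAlgorithm n r) (φ : Fin n → Fin r) :
    A.outputProb φ true + A.outputProb φ false = 1 := by
  rw [← sum_norm_sq_state A φ A.queries, outputProb, outputProb, ← Finset.sum_add_distrib]
  refine Finset.sum_congr rfl fun s _ => ?_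
  cases A.output s <;> simp

end QueryAlgorithm

/-! ### A tail bound for the number of distinct hits of a random sample. -/

section RandomSample

/-- Here `D` collects the points already drawn, and 2^(-|P ∩ D|) is a potential. While |P ∩ D| < t ≤
βN/2, with N the size of `X`, a draw hits a new point of `P` with probability at least β/2 and then
halves the potential, so each draw costs a factor 1 - β/4 on average. -/
theorem card_filter_sample_lt_le {X : Type*} [Fintype X] [DecidableEq X] (P : Finset X) {β t : ℝ}
    (hβ1 : β ≤ 1) (hP : β * Fintype.card X ≤ P.card)
    (ht : t ≤ β * Fintype.card X / 2) (k : ℕ) (D : Finset X) :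
    (∑ s : Fin k → X, if ((P ∩ (D ∪ Finset.univ.image s)).card : ℝ) < t then (1 : ℝ) else 0) ≤
      (Fintype.card X : ℝ) ^ k * (1 - β / 4) ^ k * 2 ^ (t - (P ∩ D).card) := by
  set N : ℝ := (Fintype.card X : ℝ)
  have hq : 0 ≤ 1 - β / 4 := by linarith
  have hN : 0 ≤ N := Nat.cast_nonneg _
  by_cases hD : t ≤ (P ∩ D).card
  · rw [Finset.sum_eq_zero]
    · positivity
    · intro s _
      rw [if_neg]
      rw [not_lt]
      refine hD.trans ?_
      exact_mod_cast Finset.card_le_card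
        (Finset.inter_subset_inter_left Finset.subset_union_left)
  rw [not_le] at hD
  induction k generalizing D with
  | zero =>
    have : (1 : ℝ) ≤ 2 ^ (t - (P ∩ D).card) := Real.one_le_rpow (by norm_num) (by linarith)
    simp [hD, this]
  | succ k ih =>
    have step : ∀ i, (∑ s : Fin k → X,
        if ((P ∩ (insert i D ∪ Finset.univ.image s)).card : ℝ) < t then (1 : ℝ) else 0) ≤
        N ^ k * (1 - β / 4) ^ k *
          (2 ^ (t - (P ∩ D).card) * (1 - if i ∈ P \ D then (1 / 2 : ℝ) else 0)) := by
      intro i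
      have hi : (2 : ℝ) ^ (t - (P ∩ insert i D).card) =
          2 ^ (t - (P ∩ D).card) * (1 - if i ∈ P \ D then (1 / 2 : ℝ) else 0) := by
        by_cases h : i ∈ P \ D
        · rw [Finset.mem_sdiff] at h
          rw [Finset.inter_insert_of_mem h.1, Finset.card_insert_of_notMem (by simp [h.2]),
            if_pos (by simp [h])]
          push_cast
          rw [← sub_sub, Real.rpow_sub_one (by norm_num)]
          ring
        · rw [if_neg h]
          have : P ∩ insert i D = P ∩ D := by
            ext z
            simp only [Finset.mem_inter, Finset.mem_insert]
            constructor
            · rintro ⟨hz, rfl | hz'⟩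
              · refine ⟨hz, ?_⟩
                by_contra hzD
                exact h (Finset.mem_sdiff.2 ⟨hz, hzD⟩)
              · exact ⟨hz, hz'⟩
            · exact fun hz => ⟨hz.1, Or.inr hz.2⟩
          rw [this]; ring
      rw [← hi]
      by_cases hD' : t ≤ (P ∩ insert i D).card
      · rw [Finset.sum_eq_zero]
        · positivity
        · intro s _
          rw [if_neg]
          rw [not_lt]
          refine hD'.trans ?_
          exact_mod_cast Finset.card_le_card
            (Finset.inter_subset_inter_left Finset.subset_union_left)
      · exact ih _ (not_le.1 hD')
    have hsplit : (∑ s : Fin (k + 1) → X,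
        if ((P ∩ (D ∪ Finset.univ.image s)).card : ℝ) < t then (1 : ℝ) else 0) =
        ∑ i, ∑ s : Fin k → X,
          if ((P ∩ (insert i D ∪ Finset.univ.image s)).card : ℝ) < t then (1 : ℝ) else 0 := by
      rw [← Fintype.sum_prod_type', ← (Fin.consEquiv fun _ => X).sum_comp]
      refine Finset.sum_congr rfl fun p _ => ?_
      have : D ∪ Finset.univ.image (Fin.consEquiv (fun _ => X) p) =
          insert p.1 D ∪ Finset.univ.image p.2 := by
        ext z
        simp [Fin.exists_fin_succ, Fin.consEquiv, eq_comm]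
        tauto
      rw [this]
    rw [hsplit]
    refine (Finset.sum_le_sum fun i _ => step i).trans ?_
    rw [← Finset.mul_sum, ← Finset.mul_sum]
    have hcount : ∑ i : X, (1 - if i ∈ P \ D then (1 / 2 : ℝ) else 0) =
        N - (P \ D).card / 2 := by
      rw [Finset.sum_sub_distrib, Finset.sum_ite_mem, Finset.univ_inter]
      simp [N, div_eq_mul_inv]
    have hsd : ((P \ D).card : ℝ) + (P ∩ D).card = P.card := by
      exact_mod_cast Finset.card_sdiff_add_card_inter P D
    rw [hcount]
    have h1 : N - (P \ D).card / 2 ≤ N * (1 - β / 4) := by linarith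
    calc _ ≤ N ^ k * (1 - β / 4) ^ k * (2 ^ (t - (P ∩ D).card) * (N * (1 - β / 4))) := by gcongr
      _ = _ := by ring

end RandomSample

/-! ### From sampled colliding points to marked points. -/

section Collisions

variable {n k : ℕ}

open QueryAlgorithm

theorem collisionCount_eq_zero_of_injective {φ : Fin n → Fin n} (hφ : Function.Injective φ)
    (s : Fin k → Fin n) : collisionCount φ s = 0 := by
  rw [collisionCount, Finset.card_eq_zero, Finset.filter_eq_empty_iff]
  rintro i - ⟨a, ha, h⟩
  exact ha (hφ h)

/-- The points at which `φ` is not injective. -/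
def collidingPoints (φ : Fin n → Fin n) : Finset (Fin n) :=
  Finset.univ.filter fun i => ∃ i', i' ≠ i ∧ φ i' = φ i

/-- Off the colliding points `φ` is injective. -/
theorem le_card_collidingPoints (φ : Fin n → Fin n) :
    n ≤ (collidingPoints φ).card + (Finset.univ.image φ).card := by
  have h := Finset.card_add_card_compl (collidingPoints φ)
  rw [Fintype.card_fin] at h
  have h2 : (collidingPoints φ)ᶜ.card ≤ (Finset.univ.image φ).card := by
    refine Finset.card_le_card_of_injOn φ (fun i _ => by simp) ?_
    intro i hi i' _ h
    by_contra hne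
    simp only [collidingPoints, Finset.coe_compl, Set.mem_compl_iff, Finset.mem_coe,
      Finset.mem_filter, Finset.mem_univ, true_and] at hi
    exact hi ⟨i', fun h => hne h.symm, h.symm⟩
  omega

/-- A sampled colliding point is sent to itself if it is marked, and otherwise to a partner with the
same value, which it marks. Two points with the same target have the same value, so they mark each
other and both stay fixed; hence the map is injective. -/
theorem card_sample_inter_collidingPoints_le (φ : Fin n → Fin n) (s : Fin k → Fin n) :
    (collidingPoints φ ∩ Finset.univ.image s).card ≤ collisionCount φ s := by
  classical
  have hpartner : ∀ i ∈ collidingPoints φ, ∃ i', i' ≠ i ∧ φ i' = φ i := by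
    intro i hi
    simpa [collidingPoints] using hi
  choose! p hp1 hp2 using hpartner
  refine Finset.card_le_card_of_injOn (fun i => if Collides φ s i then i else p i) ?_ ?_
  · intro i hi
    simp only [Finset.coe_inter, Set.mem_inter_iff, Finset.mem_coe, Finset.mem_image,
      Finset.mem_univ, true_and] at hi
    obtain ⟨hi, a, rfl⟩ := hi
    simp only [Finset.coe_filter, Finset.mem_univ, true_and, Set.mem_ofPred_eq]
    split_ifs with h
    · exact h
    · exact ⟨a, (hp1 _ hi).symm, (hp2 _ hi).symm⟩
  · intro i hi i' hi' h
    simp only [Finset.coe_inter, Set.mem_inter_iff, Finset.mem_coe, Finset.mem_image,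
      Finset.mem_univ, true_and] at hi hi'
    obtain ⟨hi, a, rfl⟩ := hi
    obtain ⟨hi', a', rfl⟩ := hi'
    by_contra hne
    have hφ : φ (s a) = φ (s a') := by
      dsimp only at h
      split_ifs at h with h1 h2 h2
      · exact congrArg φ h
      · rw [h, hp2 _ hi']
      · rw [← h, hp2 _ hi]
      · rw [← hp2 _ hi, h, hp2 _ hi']
    have h1 : Collides φ s (s a) := ⟨a', fun h => hne h.symm, hφ.symm⟩
    have h2 : Collides φ s (s a') := ⟨a, hne, hφ⟩
    simp only [h1, h2, if_true] at h
    exact hne h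

end Collisions

/-! ### Round lengths that double. -/

section Rounds

open Polynomial.Chebyshev

theorem prod_cos_two_pow_mul (x : ℝ) (l : ℕ) :
    ((List.range l).map fun j : ℕ => Real.cos (2 ^ j * x)).prod * (2 ^ l * Real.sin x) =
      Real.sin (2 ^ l * x) := by
  induction l with
  | zero => simp
  | succ l ih =>
    rw [List.range_succ, List.map_append, List.prod_append]
    simp only [List.map_cons, List.map_nil, List.prod_cons, List.prod_nil, mul_one]
    rw [show (2 : ℝ) ^ (l + 1) * x = 2 * (2 ^ l * x) by ring, Real.sin_two_mul, ← ih]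
    ring

/-- The product telescopes to sin(2^l x)/(2^l sin x) with cos x = 1 - w, and sin x = √(2w - w²) ≥ √w
since w ≤ 1. This is where the coin matters: without it the cosine would be 1 - 2w, and sin x would
vanish at w = 1. -/
theorem abs_prod_T_two_pow_le {w : ℝ} (hw0 : 0 < w) (hw1 : w ≤ 1) (l : ℕ) :
    |(((List.range l).map fun j : ℕ => 2 ^ j).map
      fun r : ℕ => (T ℝ r).eval (1 - w)).prod| ≤ (2 ^ l * √w)⁻¹ := by
  have hcos : Real.cos (Real.arccos (1 - w)) = 1 - w :=
    Real.cos_arccos (by linarith) (by linarith)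
  have hsin : √w ≤ Real.sin (Real.arccos (1 - w)) := by
    rw [Real.sin_arccos]
    apply Real.sqrt_le_sqrt
    nlinarith
  have hw : 0 < √w := Real.sqrt_pos.2 hw0
  set x := Real.arccos (1 - w)
  have h := prod_cos_two_pow_mul x l
  have heq : (((List.range l).map fun j : ℕ => 2 ^ j).map
      fun r : ℕ => (T ℝ r).eval (1 - w)) =
      (List.range l).map fun j : ℕ => Real.cos (2 ^ j * x) := by
    rw [List.map_map]
    refine List.map_congr_left fun j _ => ?_
    simp only [Function.comp_apply]
    rw [← hcos, T_real_cos]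
    push_cast
    rfl
  rw [heq, ← one_div, le_div_iff₀ (by positivity)]
  calc _ ≤ |((List.range l).map fun j : ℕ => Real.cos (2 ^ j * x)).prod| *
        (2 ^ l * Real.sin x) := by gcongr
    _ = |((List.range l).map fun j : ℕ => Real.cos (2 ^ j * x)).prod * (2 ^ l * Real.sin x)| := by
      rw [abs_mul, abs_of_nonneg (a := 2 ^ l * Real.sin x)]
      have := hw.le.trans hsin
      positivity
    _ ≤ 1 := by rw [h]; exact Real.abs_sin_le_one _

theorem abs_prod_T_le_one {c : ℝ} (hc : |c| ≤ 1) (l : List ℕ) :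
    |(l.map fun r : ℕ => (T ℝ r).eval c).prod| ≤ 1 := by
  induction l with
  | nil => simp
  | cons r l ih =>
    rw [List.map_cons, List.prod_cons, abs_mul]
    refine mul_le_one₀ ?_ (abs_nonneg _) ih
    exact abs_eval_T_real_le_one r hc

theorem sum_round_cost_le (l : ℕ) :
    (((List.range l).map fun j : ℕ => 2 ^ j).map fun r => 2 * r + 2).sum ≤ 4 * 2 ^ l := by
  suffices h : (((List.range l).map fun j : ℕ => 2 ^ j).map fun r => 2 * r + 2).sum + 2 =
      2 * 2 ^ l + 2 * l by
    have := l.lt_two_pow_self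
    omega
  induction l with
  | zero => simp
  | succ l ih =>
    rw [List.range_succ]
    simp only [List.map_append, List.map_cons, List.map_nil, List.sum_append, List.sum_cons,
      List.sum_nil]
    rw [pow_succ]
    omega

end Rounds

-- The two error terms are the probability of a sample with fewer than `t` distinct colliding
-- points, and the failure of all `R` searches on a good sample.
open QueryAlgorithm in
theorem exists_injectivity_tester {n : ℕ} (hn : 1 ≤ n) {β t : ℝ} (hβ1 : β ≤ 1)
    (ht0 : 0 < t) (ht : t ≤ β * n / 2) (k R l : ℕ) (hl : 2 * √(n / t) ≤ 2 ^ l) :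
    ∃ A : QueryAlgorithm n n, A.queries ≤ k + 2 + R * (4 * 2 ^ l) ∧
      (∀ φ, Function.Injective φ → A.outputProb φ true = 1) ∧
      ∀ φ, ((Finset.univ.image φ).card : ℝ) ≤ (1 - β) * n →
        A.outputProb φ true ≤ 2 ^ t * (1 - β / 4) ^ k + (1 / 4) ^ R := by
  have : NeZero n := ⟨by omega⟩
  have hn' : (0 : ℝ) < n := by exact_mod_cast hn
  obtain ⟨A, hA, hprob⟩ := exists_collision_search n k
    (List.replicate R ((List.range l).map fun j : ℕ => 2 ^ j)).flatten
  refine ⟨A, ?_, fun φ hφ => ?_, fun φ hφ => ?_⟩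
  · rw [hA, List.map_flatten, List.map_replicate, List.sum_flatten, List.map_replicate,
      List.sum_replicate, smul_eq_mul, add_assoc]
    have := sum_round_cost_le l
    gcongr
  · rw [hprob]
    simp only [collisionCount_eq_zero_of_injective hφ, Nat.cast_zero, zero_div, sub_zero,
      Polynomial.Chebyshev.T_eval_one, List.map_const', List.prod_replicate]
    simp [hn'.ne']
  · rw [hprob]
    set P := collidingPoints φ
    have hP : β * Fintype.card (Fin n) ≤ P.card := by
      have : (n : ℝ) ≤ P.card + (Finset.univ.image φ).card := by
        exact_mod_cast le_card_collidingPoints φ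
      rw [Fintype.card_fin]
      linarith
    have hbad := card_filter_sample_lt_le P hβ1 hP (by simpa using ht) k ∅
    simp only [Finset.empty_union, Finset.inter_empty, Finset.card_empty, Nat.cast_zero, sub_zero,
      Fintype.card_fin] at hbad
    have hterm : ∀ s : Fin k → Fin n,
        ((List.replicate R ((List.range l).map fun j : ℕ => 2 ^ j)).flatten.map fun r : ℕ =>
          (Polynomial.Chebyshev.T ℝ r).eval (1 - collisionCount φ s / n : ℝ)).prod ^ 2 *
          (1 - collisionCount φ s / (2 * n)) ≤
        (if ((P ∩ Finset.univ.image s).card : ℝ) < t then (1 : ℝ) else 0) + (1 / 4) ^ R := by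
      intro s
      set m : ℝ := (collisionCount φ s : ℝ)
      have hm0 : 0 ≤ m := Nat.cast_nonneg _
      have hmn : m / n ≤ 1 := by
        rw [div_le_one hn']
        have : collisionCount φ s ≤ n := (Finset.card_le_univ _).trans_eq (Fintype.card_fin n)
        exact Nat.cast_le.2 this
      have hfac : 1 - m / (2 * n) ≤ 1 := by
        have : 0 ≤ m / (2 * n) := by positivity
        linarith
      refine (mul_le_of_le_one_right (sq_nonneg _) hfac).trans ?_
      split_ifs with hs
      · have := abs_prod_T_le_one (c := 1 - m / n) (by
          rw [abs_le]; constructor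
          · linarith
          · have : 0 ≤ m / n := by positivity
            linarith) (List.replicate R ((List.range l).map fun j : ℕ => 2 ^ j)).flatten
        have h2 := (sq_le_one_iff_abs_le_one _).2 this
        have h4 : (0 : ℝ) ≤ (1 / 4) ^ R := by positivity
        linarith
      · rw [List.map_flatten, List.map_replicate, List.prod_flatten, List.map_replicate,
          List.prod_replicate, zero_add, ← pow_mul, mul_comm, pow_mul]
        refine pow_le_pow_left₀ (sq_nonneg _) ?_ R
        have htm : t ≤ m := (not_lt.1 hs).trans
          (Nat.cast_le.2 (card_sample_inter_collidingPoints_le φ s))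
        have hw0 : 0 < m / n := div_pos (ht0.trans_le htm) hn'
        have h1 := abs_prod_T_two_pow_le hw0 hmn l
        -- One block of doubling rounds halves the amplitude, hence quarters the probability.
        have h2 : (2 ^ l * √(m / n))⁻¹ ≤ 1 / 2 := by
          rw [one_div]
          apply inv_anti₀ (by norm_num)
          calc (2 : ℝ) = 2 * √(n / t) * √(t / n) := by
                rw [mul_assoc, ← Real.sqrt_mul (by positivity)]
                rw [div_mul_div_cancel₀ ht0.ne', div_self hn'.ne']
                simp
            _ ≤ 2 ^ l * √(m / n) := by gcongr
        rw [← sq_abs]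
        have := pow_le_pow_left₀ (abs_nonneg _) (h1.trans h2) 2
        norm_num at this ⊢
        exact this
    calc _ ≤ (n ^ k : ℝ)⁻¹ * ∑ s : Fin k → Fin n,
          ((if ((P ∩ Finset.univ.image s).card : ℝ) < t then (1 : ℝ) else 0) + (1 / 4) ^ R) := by
          gcongr with s; exact hterm s
      _ ≤ (n ^ k : ℝ)⁻¹ * (n ^ k * (1 - β / 4) ^ k * 2 ^ t + n ^ k * (1 / 4) ^ R) := by
          rw [Finset.sum_add_distrib]
          gcongr
          simp
      _ = _ := by field_simp

/-! ### The polynomial method. -/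

section PolynomialMethod

open MvPolynomial

/-- The amplitudes of `ψ x`, for `x ∈ S`, are values of complex polynomials of degree at most `d`,
given by their real and imaginary parts. -/
def HasPolynomialAmplitudes {σ X : Type*} (S : Set (σ → ℝ)) (d : ℕ)
    (ψ : ∀ x ∈ S, X → ℂ) : Prop :=
  ∃ p q : X → MvPolynomial σ ℝ, (∀ s, (p s).totalDegree ≤ d ∧ (q s).totalDegree ≤ d) ∧
    ∀ x hx s, ψ x hx s = (eval x (p s) : ℂ) + (eval x (q s) : ℂ) * Complex.I

theorem HasPolynomialAmplitudes.mulVec {σ X : Type*} [Fintype X] {S : Set (σ → ℝ)} {d : ℕ}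
    {ψ : ∀ x ∈ S, X → ℂ} (h : HasPolynomialAmplitudes S d ψ) (M : Matrix X X ℂ) :
    HasPolynomialAmplitudes S d (fun x hx => Matrix.mulVec M (ψ x hx)) := by
  obtain ⟨p, q, hd, he⟩ := h
  have hC : ∀ (a : ℝ) (f : MvPolynomial σ ℝ), f.totalDegree ≤ d → (C a * f).totalDegree ≤ d :=
    fun a f hf => (totalDegree_mul _ _).trans (by simpa using hf)
  refine ⟨fun s => ∑ s', (C (M s s').re * p s' - C (M s s').im * q s'),
    fun s => ∑ s', (C (M s s').re * q s' + C (M s s').im * p s'), fun s => ⟨?_, ?_⟩, ?_⟩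
  · refine totalDegree_finsetSum_le fun s' _ => (totalDegree_sub _ _).trans ?_
    exact max_le (hC _ _ (hd s').1) (hC _ _ (hd s').2)
  · refine totalDegree_finsetSum_le fun s' _ => (totalDegree_add _ _).trans ?_
    exact max_le (hC _ _ (hd s').2) (hC _ _ (hd s').1)
  · intro x hx s
    simp only [Matrix.mulVec, dotProduct, he, map_sum, map_sub, map_add, map_mul, eval_C,
      Complex.ofReal_sum, Finset.sum_mul, ← Finset.sum_add_distrib]
    refine Finset.sum_congr rfl fun s' _ => ?_
    apply Complex.ext <;> simp

/-- On `rowMatrices`, ψ(i, b - φ(i), w) = ∑ⱼ x(i, j) ψ(i, b - j, w), so a query raises the degree by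
one. -/
theorem HasPolynomialAmplitudes.query {n r d : ℕ} {W : Type}
    {ψ : ∀ x ∈ rowMatrices n r, Fin n × Fin r × W → ℂ}
    (h : HasPolynomialAmplitudes (rowMatrices n r) d ψ) :
    HasPolynomialAmplitudes (rowMatrices n r) (d + 1)
      (fun x hx => QueryAlgorithm.query (toMapping x hx) (ψ x hx)) := by
  obtain ⟨p, q, hd, he⟩ := h
  have hX : ∀ (a : Fin n × Fin r) (f : MvPolynomial (Fin n × Fin r) ℝ), f.totalDegree ≤ d →
      (X a * f).totalDegree ≤ d + 1 := by
    intro a f hf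
    refine (totalDegree_mul _ _).trans ?_
    rw [totalDegree_X]
    omega
  refine ⟨fun s => ∑ j, X (s.1, j) * p (s.1, s.2.1 - j, s.2.2),
    fun s => ∑ j, X (s.1, j) * q (s.1, s.2.1 - j, s.2.2), fun s => ⟨?_, ?_⟩, ?_⟩
  · exact totalDegree_finsetSum_le fun j _ => hX _ _ (hd _).1
  · exact totalDegree_finsetSum_le fun j _ => hX _ _ (hd _).2
  · intro x hx s
    have hx' : ∀ f : Fin r → ℝ, ∑ j, x (s.1, j) * f j = f (toMapping x hx s.1) := by
      intro f
      rw [Finset.sum_eq_single (toMapping x hx s.1)]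
      · rw [(toMapping_eq_iff hx _ _).1 rfl, one_mul]
      · intro j _ hj
        have : x (s.1, j) ≠ 1 := fun h => hj ((toMapping_eq_iff hx _ _).2 h).symm
        rw [(hx.1 (s.1, j)).resolve_right this, zero_mul]
      · simp
    simp only [QueryAlgorithm.query, he, map_sum, map_mul, eval_X]
    rw [hx' fun j => eval x (p (s.1, s.2.1 - j, s.2.2)),
      hx' fun j => eval x (q (s.1, s.2.1 - j, s.2.2))]

theorem QueryAlgorithm.hasPolynomialAmplitudes_state {n r : ℕ} (A : QueryAlgorithm n r) (t : ℕ) :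
    HasPolynomialAmplitudes (rowMatrices n r) t (fun x hx => A.state (toMapping x hx) t) := by
  induction t with
  | zero =>
    refine HasPolynomialAmplitudes.mulVec (ψ := fun _ _ => Pi.single A.start 1) ?_ _
    refine ⟨Pi.single A.start 1, 0, fun s => ⟨?_, by simp⟩, fun x hx s => ?_⟩
    · by_cases h : s = A.start
      · subst h; simp
      · simp [Pi.single_eq_of_ne h]
    · by_cases h : s = A.start
      · subst h; simp
      · simp [Pi.single_eq_of_ne h]
  | succ t ih => exact ih.query.mulVec _

/-- The acceptance probability of a quantum query algorithm is a polynomial in the entries of the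
input matrix, of degree at most twice the number of queries. -/
theorem QueryAlgorithm.exists_outputProb_eq_eval {n r : ℕ} (A : QueryAlgorithm n r) :
    ∃ p : MvPolynomial (Fin n × Fin r) ℝ, p.totalDegree ≤ 2 * A.queries ∧
      ∀ x hx, A.outputProb (toMapping x hx) true = eval x p := by
  obtain ⟨p, q, hd, he⟩ := A.hasPolynomialAmplitudes_state A.queries
  have hsq : ∀ f : MvPolynomial (Fin n × Fin r) ℝ, f.totalDegree ≤ A.queries →
      (f ^ 2).totalDegree ≤ 2 * A.queries :=
    fun f hf => (totalDegree_pow _ _).trans (by omega)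
  refine ⟨∑ s, if A.output s = true then p s ^ 2 + q s ^ 2 else 0, ?_, fun x hx => ?_⟩
  · refine totalDegree_finsetSum_le fun s _ => ?_
    split_ifs
    · exact (totalDegree_add _ _).trans (max_le (hsq _ (hd s).1) (hsq _ (hd s).2))
    · simp
  · rw [outputProb, map_sum]
    refine Finset.sum_congr rfl fun s _ => ?_
    split_ifs
    · have hs := he x hx s
      beta_reduce at hs
      rw [hs, ← Complex.normSq_eq_norm_sq, Complex.normSq_add_mul_I]
      simp
    · simp

theorem polyDegree_le_totalDegree {σ : Type*} (p : MvPolynomial σ ℝ) :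
    polyDegree p ≤ ((p.totalDegree : ℕ∞) : WithBot ℕ∞) := by
  refine Finset.sup_le fun m hm => ?_
  have : m.degree ≤ p.totalDegree := le_totalDegree hm
  exact_mod_cast this

theorem zero_le_polyDegree {σ : Type*} {p : MvPolynomial σ ℝ} (hp : p ≠ 0) :
    0 ≤ polyDegree p := by
  obtain ⟨m, hm⟩ := support_nonempty.2 hp
  refine le_trans ?_ (Finset.le_sup (f := fun m => ((m.degree : ℕ∞) : WithBot ℕ∞)) hm)
  exact_mod_cast Nat.zero_le m.degree

/-- A point with `ε < |f x|` excludes the zero polynomial, whose degree is `⊥`; so the infimum is a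
natural number. -/
theorem exists_approxDegree_eq {σ : Type*} {X : Set (σ → ℝ)} {ε : ℝ} {f : X → ℝ}
    (hf : ∃ x, ε < |f x|) {p : MvPolynomial σ ℝ} (hp : ∀ x : X, |eval x.1 p - f x| ≤ ε) :
    ∃ d : ℕ, approxDegree ε f = ((d : ℕ∞) : WithBot ℕ∞) ∧ d ≤ p.totalDegree := by
  have hle : approxDegree ε f ≤ ((p.totalDegree : ℕ∞) : WithBot ℕ∞) :=
    (iInf₂_le p hp).trans (polyDegree_le_totalDegree p)
  have hge : 0 ≤ approxDegree ε f := by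
    refine le_iInf₂ fun q hq => zero_le_polyDegree ?_
    rintro rfl
    obtain ⟨x, hx⟩ := hf
    have := hq x
    simp at this
    linarith
  cases h : approxDegree ε f with
  | bot => rw [h] at hge; simp at hge
  | coe a =>
    rw [h] at hle
    have ha : a ≤ (p.totalDegree : ℕ∞) := by exact_mod_cast hle
    lift a to ℕ using ne_top_of_le_ne_top (ENat.natCast_ne_top _) ha
    exact ⟨a, rfl, by exact_mod_cast ha⟩

end PolynomialMethod

/-! ### Choice of parameters for permutation testing. -/

section PermutationTesting

theorem columnCount_eq_card_image {n r : ℕ} {x : Fin n × Fin r → ℝ} (hx : x ∈ rowMatrices n r) :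
    columnCount x = (Finset.univ.image (toMapping x hx)).card := by
  rw [columnCount, ← Set.ncard_coe_finset]
  congr 1
  ext j
  simp [toMapping_eq_iff]

theorem columnCount_eq_iff_injective {n : ℕ} {x : Fin n × Fin n → ℝ} (hx : x ∈ rowMatrices n n) :
    columnCount x = n ↔ Function.Injective (toMapping x hx) := by
  rw [columnCount_eq_card_image hx]
  simpa using Finset.card_image_iff (s := Finset.univ) (f := toMapping x hx)

/-- The matrix of the identity is a positive instance of the permutation testing problem. -/
theorem exists_ptp_eq_true (n : ℕ) (α : ℝ) : ∃ x : ptpDomain n α, ptp n α x = true := by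
  have hx : (fun p => if p.1 = p.2 then 1 else 0 : Fin n × Fin n → ℝ) ∈ rowMatrices n n := by
    refine ⟨fun p => ?_, fun i => ⟨i, by simp, fun j hj => ?_⟩⟩
    · by_cases h : p.1 = p.2 <;> simp [h]
    · by_contra h
      simp [Ne.symm h] at hj
  have hcol := (columnCount_eq_iff_injective hx).2 (by
    have : toMapping _ hx = id := funext fun i => (toMapping_eq_iff hx i i).2 (by simp)
    rw [this]
    exact Function.injective_id)
  exact ⟨⟨_, hx, Or.inl hcol⟩, by simp [ptp, hcol]⟩

/-- The first term is at most e^X e^(-5X) = e^(-4X) ≤ e^(-2L) = ε², the second is also at most ε²,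
and 2ε² ≤ ε. -/
theorem two_rpow_mul_pow_add_le {β X L ε t : ℝ} {k R : ℕ} (hβ0 : 0 < β) (hβ1 : β ≤ 1)
    (hLX : L ≤ 2 * X) (hε : ε ≤ 1 / 3) (hεL : Real.exp (-L) = ε)
    (ht0 : 0 ≤ t) (ht : t ≤ X) (hk : 20 * X / β ≤ k) (hR : 2 * L ≤ R) :
    2 ^ t * (1 - β / 4) ^ k + (1 / 4) ^ R ≤ ε := by
  have h1 : (2 : ℝ) ^ t ≤ Real.exp X := by
    calc (2 : ℝ) ^ t ≤ Real.exp 1 ^ t :=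
          Real.rpow_le_rpow (by norm_num) (by linarith [Real.add_one_le_exp 1]) ht0
      _ = Real.exp t := Real.exp_one_rpow t
      _ ≤ Real.exp X := Real.exp_le_exp.2 ht
  have h2 : (1 - β / 4) ^ k ≤ Real.exp (-(5 * X)) := by
    calc (1 - β / 4) ^ k ≤ Real.exp (-(β / 4)) ^ k :=
          pow_le_pow_left₀ (by linarith) (by linarith [Real.add_one_le_exp (-(β / 4))]) k
      _ = Real.exp (k * -(β / 4)) := (Real.exp_nat_mul _ _).symm
      _ ≤ Real.exp (-(5 * X)) := by
          rw [div_le_iff₀ hβ0] at hk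
          exact Real.exp_le_exp.2 (by linarith)
  have h3 : (1 / 4 : ℝ) ^ R ≤ Real.exp (-(2 * L)) := by
    calc (1 / 4 : ℝ) ^ R ≤ Real.exp (-1) ^ R := by
          refine pow_le_pow_left₀ (by norm_num) ?_ R
          rw [Real.exp_neg, one_div]
          exact inv_anti₀ (Real.exp_pos 1) (by linarith [Real.exp_one_lt_d9])
      _ = Real.exp (R * -1) := (Real.exp_nat_mul _ _).symm
      _ ≤ Real.exp (-(2 * L)) := Real.exp_le_exp.2 (by linarith)
  have h4 : 2 ^ t * (1 - β / 4) ^ k ≤ Real.exp (-(2 * L)) := by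
    calc 2 ^ t * (1 - β / 4) ^ k ≤ Real.exp X * Real.exp (-(5 * X)) := by
          gcongr
          exact pow_nonneg (by linarith) k
      _ = Real.exp (-(4 * X)) := by rw [← Real.exp_add]; congr 1; ring
      _ ≤ Real.exp (-(2 * L)) := Real.exp_le_exp.2 (by linarith)
  have h5 : Real.exp (-(2 * L)) = ε ^ 2 := by
    rw [← hεL, ← Real.exp_nat_mul]; congr 1; push_cast; ring
  have h6 : 0 < ε := hεL ▸ Real.exp_pos _
  nlinarith

theorem exists_ptp_algorithm {α : ℝ} (hα0 : 0 < α) (hα1 : α < 1) {n : ℕ} (hn : 1 ≤ n) {ε : ℝ}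
    (hε0 : 1 / 3 ^ n ≤ ε) (hε1 : ε ≤ 1 / 3) :
    ∃ A : QueryAlgorithm n n, A.ComputesWithError (ptpDomain_subset n α) (ptp n α) ε ∧
      (A.queries : ℝ) ≤ 119 / (1 - α) *
        ((n : ℝ) ^ (1 / 3 : ℝ) * Real.log (1 / ε) ^ (2 / 3 : ℝ)) := by
  set β := 1 - α with hβ_def
  have hβ0 : 0 < β := by linarith
  have hβ1 : β ≤ 1 := by linarith
  set L := Real.log (1 / ε)
  set X := (n : ℝ) ^ (1 / 3 : ℝ) * L ^ (2 / 3 : ℝ) with hX_def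
  have hn1 : (1 : ℝ) ≤ n := by exact_mod_cast hn
  have hε : 0 < ε := lt_of_lt_of_le (by positivity) hε0
  have hL1 : 1 ≤ L := by
    rw [Real.le_log_iff_exp_le (by positivity)]
    calc Real.exp 1 ≤ 3 := by linarith [Real.exp_one_lt_d9]
      _ ≤ 1 / ε := by rw [le_div_iff₀ hε]; linarith
  have hLn : L ≤ 2 * n := by
    have h : 1 / ε ≤ 3 ^ n := by
      rw [div_le_iff₀ hε, ← div_le_iff₀' (by positivity)]; exact hε0
    calc L ≤ Real.log (3 ^ n) := Real.log_le_log (by positivity) h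
      _ = n * Real.log 3 := Real.log_pow _ _
      _ ≤ n * 2 := by
          gcongr
          linarith [Real.log_le_sub_one_of_pos (show (0 : ℝ) < 3 by norm_num)]
      _ = 2 * n := mul_comm _ _
  have hεL : Real.exp (-L) = ε := by
    rw [← Real.log_inv, one_div, inv_inv, Real.exp_log hε]
  have hX3 : X ^ 3 = n * L ^ 2 := by
    rw [hX_def, mul_pow, ← Real.rpow_natCast, ← Real.rpow_natCast, ← Real.rpow_mul (by linarith),
      ← Real.rpow_mul (by linarith)]
    norm_num
  have hX0 : 0 ≤ X := by positivity
  have hX1 : 1 ≤ X := by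
    refine le_of_pow_le_pow_left₀ (n := 3) (by norm_num) hX0 ?_
    rw [hX3]
    nlinarith
  have hLX : L ≤ 2 * X := by
    refine le_of_pow_le_pow_left₀ (n := 3) (by norm_num) (by positivity) ?_
    rw [mul_pow, hX3]
    nlinarith [sq_nonneg L]
  have hXn : X ≤ 2 * n := by
    refine le_of_pow_le_pow_left₀ (n := 3) (by norm_num) (by positivity) ?_
    rw [hX3]
    have : L ^ 2 ≤ (2 * n) ^ 2 := pow_le_pow_left₀ (by linarith) hLn 2
    nlinarith [sq_nonneg (n : ℝ), pow_pos (show (0 : ℝ) < n by linarith) 3]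
  -- As X ≤ 2n, this is the largest multiple of βX for which that bound gives t ≤ βn/2.
  set t := β * X / 4 with ht_def
  have ht0 : 0 < t := by positivity
  have htn : t ≤ β * n / 2 := by rw [ht_def]; nlinarith
  have hnt : 1 ≤ n / t := by rw [le_div_iff₀ ht0]; nlinarith
  -- Rounding up to a power of two gives 2√(n/t) < 2^(m+1) ≤ 4√(n/t).
  obtain ⟨m, hm1, hm2⟩ := exists_nat_pow_near (x := 2 * √(n / t)) (y := 2)
    (by linarith [Real.one_le_sqrt.2 hnt]) (by norm_num)
  obtain ⟨A, hA, hinj, hfar⟩ := exists_injectivity_tester hn hβ1 ht0 htn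
    ⌈20 * X / β⌉₊ ⌈2 * L⌉₊ (m + 1) hm2.le
  refine ⟨A, fun x => ?_, ?_⟩
  · have hx := ptpDomain_subset n α x.2
    cases h : ptp n α x with
    | true =>
      have hcol : columnCount x.1 = n := by simpa [ptp] using h
      have := hinj _ ((columnCount_eq_iff_injective hx).1 hcol)
      have hsum := A.outputProb_true_add_false (toMapping x.1 hx)
      rw [Bool.not_true]
      linarith
    | false =>
      have hcol : columnCount x.1 ≠ n := by simpa [ptp] using h
      have hcol' := x.2.2.resolve_left hcol
      rw [columnCount_eq_card_image hx] at hcol'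
      rw [Bool.not_false]
      refine (hfar _ (by rw [hβ_def, sub_sub_cancel]; exact hcol')).trans ?_
      exact two_rpow_mul_pow_add_le hβ0 hβ1 hLX hε1 hεL ht0.le (by rw [ht_def]; nlinarith)
        (Nat.le_ceil _) (Nat.le_ceil _)
  · have hsqrt : L * √(n / t) ≤ 2 * X / β := by
      refine le_of_pow_le_pow_left₀ (n := 2) (by norm_num) (by positivity) ?_
      rw [mul_pow, Real.sq_sqrt (by positivity), ht_def, div_pow, mul_pow,
        show L ^ 2 * (n / (β * X / 4)) = 4 * (n * L ^ 2) / (β * X) by field_simp, ← hX3,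
        div_le_div_iff₀ (by positivity) (by positivity)]
      have : β ^ 2 * X ^ 3 ≤ β * X ^ 3 := by
        gcongr
        nlinarith
      nlinarith
    have hk : (⌈20 * X / β⌉₊ : ℝ) ≤ 20 * X / β + 1 := (Nat.ceil_lt_add_one (by positivity)).le
    have hR : (⌈2 * L⌉₊ : ℝ) ≤ 3 * L := by
      linarith [Nat.ceil_lt_add_one (show 0 ≤ 2 * L by linarith)]
    have hXβ : X ≤ X / β := by rw [le_div_iff₀ hβ0]; nlinarith
    calc (A.queries : ℝ) ≤ ⌈20 * X / β⌉₊ + 2 + ⌈2 * L⌉₊ * (4 * 2 ^ (m + 1)) := by exact_mod_cast hA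
      _ ≤ 20 * X / β + 1 + 2 + 3 * L * (4 * (2 * (2 * √(n / t)))) := by
          rw [pow_succ']
          gcongr
      _ = 20 * (X / β) + 3 + 48 * (L * √(n / t)) := by ring
      _ ≤ 20 * (X / β) + 3 * (X / β) + 48 * (2 * X / β) := by linarith
      _ = 119 / β * X := by ring

end PermutationTesting

theorem mainTheorem7 (α : ℝ) (hα0 : 0 < α) (hα1 : α < 1) :
    ∃ C : ℝ, ∀ n : ℕ, 1 ≤ n → ∀ ε : ℝ, 1 / 3 ^ n ≤ ε → ε ≤ 1 / 3 →
      (∃ A : QueryAlgorithm n n,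
        A.ComputesWithError (ptpDomain_subset n α) (ptp n α) ε ∧
        (A.queries : ℝ) ≤ C * ((n : ℝ) ^ (1 / 3 : ℝ) * Real.log (1 / ε) ^ (2 / 3 : ℝ))) ∧
      (∃ d : ℕ,
        approxDegree ε (fun x : ptpDomain n α => if ptp n α x then (1 : ℝ) else 0) =
          ((d : ℕ∞) : WithBot ℕ∞) ∧
        (d : ℝ) ≤ C * ((n : ℝ) ^ (1 / 3 : ℝ) * Real.log (1 / ε) ^ (2 / 3 : ℝ))) := by
  -- The factor 2 is the passage from queries to degree.
  refine ⟨2 * (119 / (1 - α)), fun n hn ε hε0 hε1 => ?_⟩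
  obtain ⟨A, hA, hq⟩ := exists_ptp_algorithm hα0 hα1 hn hε0 hε1
  refine ⟨⟨A, hA, by linarith [Nat.cast_nonneg (α := ℝ) A.queries]⟩, ?_⟩
  obtain ⟨p, hp, hpe⟩ := A.exists_outputProb_eq_eval
  obtain ⟨d, hd, hdp⟩ := exists_approxDegree_eq (ε := ε)
    (f := fun x : ptpDomain n α => if ptp n α x then (1 : ℝ) else 0) (p := p) (by
      obtain ⟨x, hx⟩ := exists_ptp_eq_true n α
      refine ⟨x, ?_⟩
      rw [hx]
      norm_num
      linarith) (by
      intro x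
      have hx := ptpDomain_subset n α x.2
      have herr := hA x
      have hsum := A.outputProb_true_add_false (toMapping x.1 hx)
      have hnn : ∀ b, 0 ≤ A.outputProb (toMapping x.1 hx) b := fun b =>
        Finset.sum_nonneg fun s _ => by split_ifs <;> positivity
      have h1 := hnn true
      have h2 := hnn false
      rw [← hpe x.1 hx, abs_le]
      cases h : ptp n α x <;> simp only [h, Bool.not_true, Bool.not_false] at herr <;>
        constructor <;> simp <;> linarith)
  refine ⟨d, hd, ?_⟩
  have : (d : ℝ) ≤ 2 * A.queries := by exact_mod_cast hdp.trans hp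
  linarith
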